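/- **Setting.** Let $\mathcal X$ be a finite universe. A database is a histogram $\mathcal D\in\mathbb N^{\mathcal X}$; databases $\mathcal D,\mathcal D'$ are adjacent if $\|\mathcal D-\mathcal D'\|_1\le 1$. A randomized algorithm $M$ is $(\epsilon,\delta)$-differentially private if $\Pr[M(\mathcal D)\in S]\le e^{\epsilon}\Pr[M(\mathcal D')\in S]+\delta$ for all adjacent $\mathcal D,\mathcal D'$ and all measurable sets $S$ of outputs. Let $\mathcal Q\subseteq[0,1]^{\mathcal X}$ be a class of linear queries, with $Q(\mathcal D)=\sum_{x}Q_x\mathcal D_x$. **Iterative database constructions.** An update rule consists of a set $\mathcal R$ of data structures with a value $Q(d)\in\mathbb R$ for each $Q\in\mathcal Q$, $d\in\mathcal R$, an initial structure $\mathbf U(\emptyset,\cdot,\cdot)\in\mathcal R$, and a map $\mathbf U:\mathcal R\times\mathcal Q\times\mathbb R\to\mathcal R$ (the map and the evaluation being measurable). A $(\mathbf U,\mathcal D,\mathcal Q,\alpha,C)$-database update sequence is a sequence $(D^t,Q^t,a^t)_{t=1}^{C}$ in $\mathcal R\times\mathcal Q\times\mathbb R$ with $D^1=\mathbf U(\emptyset,\cdot,\cdot)$,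 with $|Q^t(\mathcal D)-Q^t(D^t)|\ge\alpha$ and $|Q^t(\mathcal D)-a^t|<\alpha$ for all $t\le C$, and with $D^{t+1}=\mathbf U(D^t,Q^t,a^t)$ for all $t<C$. For $B:\mathbb R\to\mathbb R$, $\mathbf U$ is a $B(\alpha)$-iterative database construction for $\mathcal Q$ if, for every database $\mathcal D$, every $(\mathbf U,\mathcal D,\mathcal Q,\alpha,C)$-database update sequence satisfies $C\le B(\alpha)$. **Mechanism.** Let $\alpha>0$, $\epsilon,\delta,\beta\in(0,1]$, $k\in\mathbb N$, and let $\mathbf U$ be a $B(\alpha)$-iterative database construction for $\mathcal Q$. Put $$\sigma=\frac{1000\sqrt{B(\alpha)}\,\log(4/\delta)}{\epsilon},\qquad T=4\sigma\log(2k/\beta).$$ On input $\mathcal D$, the mechanism starts with $D^1=\mathbf U(\emptyset,\cdot,\cdot)$ and $C=0$. In each round $t=1,\dots,k$ it receives a query $Q^t\in\mathcal Q$, draws a fresh independent $z_t\sim\mathrm{Lap}(\sigma)$ (density $\frac1{2\sigma}e^{-|x|/\sigma}$), and sets $\hat a^t=Q^t(\mathcal D)+z_t$. * If $|\hat a^t-Q^t(D^t)|\le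 T$, it outputs $Q^t(D^t)$ and sets $D^{t+1}=D^t$. * Otherwise it outputs $\hat a^t$, sets $D^{t+1}=\mathbf U(D^t,Q^t,\hat a^t)$, and increases $C$ by $1$. At the end of the round it terminates if $C\ge B(\alpha)$. The queries are supplied by an arbitrary adaptive adversary with private random coins independent of the noise: $Q^t$ is a measurable function of the coins and of the queries and answers of the rounds before $t$. The output of the mechanism is the adversary's view, that is, the coins together with the whole transcript of queries and answers up to termination. **Theorem.** For every such $\mathcal X$, $\mathcal Q$, $\mathbf U$, $B$, $\alpha$, $\epsilon$, $\delta$, $\beta$, $k$, and for every such adversary, the mechanism is $(\epsilon,\delta)$-differentially private. -/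

import Mathlib

open MeasureTheory

noncomputable section

namespace OnlineQuery

/-- A database, as a histogram over the (finite) universe `X`. -/
abbrev Database (X : Type*) := X → ℕ

/-- Two databases are adjacent if their histograms are at `ℓ¹` distance at most one. -/
def Adjacent {X : Type*} [Fintype X] (D D' : Database X) : Prop :=
  ∑ x, |(D x : ℝ) - (D' x : ℝ)| ≤ 1

/-- `(ε, δ)`-differential privacy of a randomized algorithm, given by its output laws `M D`. -/
def DifferentiallyPrivate {X Y : Type*} [Fintype X] [MeasurableSpace Y]
    (ε δ : ℝ) (M : Database X → Measure Y) : Prop :=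
  ∀ D D' : Database X, Adjacent D D' → ∀ S : Set Y, MeasurableSet S →
    M D S ≤ ENNReal.ofReal (Real.exp ε) * M D' S + ENNReal.ofReal δ

/-- The Laplace distribution centred at `0` with scale `b > 0`. -/
def laplace (b : ℝ) : Measure ℝ :=
  volume.withDensity fun x => ENNReal.ofReal (1 / (2 * b) * Real.exp (-(|x| / b)))

/-- The value `Q(D) = Q · D` of the linear query with coefficient vector `Q`. -/
def linearValue {X : Type*} [Fintype X] (Q : X → ℝ) (D : Database X) : ℝ :=
  ∑ x, Q x * (D x : ℝ)

/-- An update rule for the query class `𝒬` on the set `R` of data structures: the initial structure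
`U(∅, ·, ·)`, the map `U : R × 𝒬 × ℝ → R`, and the value `Q(d)` that a data structure `d` assigns
to a query `Q`. -/
structure UpdateRule {X : Type*} (𝒬 : Set (X → ℝ)) (R : Type*) where
  init : R
  update : R → 𝒬 → ℝ → R
  eval : 𝒬 → R → ℝ

/-- `(d t, q t, a t)`, for `t < C`, is a `(U, D, 𝒬, α, C)`-database update sequence. -/
structure IsUpdateSequence {X R : Type*} [Fintype X] {𝒬 : Set (X → ℝ)} (U : UpdateRule 𝒬 R)
    (D : Database X) (α : ℝ) (C : ℕ) (d : Fin C → R) (q : Fin C → 𝒬) (a : Fin C → ℝ) : Prop where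
  start : ∀ h : 0 < C, d ⟨0, h⟩ = U.init
  distinguishes : ∀ t, α ≤ |linearValue (q t : X → ℝ) D - U.eval (q t) (d t)|
  approximates : ∀ t, |linearValue (q t : X → ℝ) D - a t| < α
  step : ∀ (t : Fin C) (h : (t : ℕ) + 1 < C), d ⟨t + 1, h⟩ = U.update (d t) (q t) (a t)

/-- `U` is a `B(α)`-iterative database construction for `𝒬`: for every database, every
database update sequence has length at most `B(α)`. -/
def IsIDC {X R : Type*} [Fintype X] {𝒬 : Set (X → ℝ)} (U : UpdateRule 𝒬 R)
    (B : ℝ → ℝ) (α : ℝ) : Prop :=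
  ∀ (D : Database X) (C : ℕ) (d : Fin C → R) (q : Fin C → 𝒬) (a : Fin C → ℝ),
    IsUpdateSequence U D α C d q a → (C : ℝ) ≤ B α

/-- Noise scale `σ = 1000 √B log(4/δ) / ε`, where `b` is the value `B(α)`. -/
def noiseScale (b ε δ : ℝ) : ℝ :=
  1000 * Real.sqrt b * Real.log (4 / δ) / ε

/-- Update threshold `T = 4 σ log(2k/β)`. -/
def threshold (b ε δ β : ℝ) (k : ℕ) : ℝ :=
  4 * noiseScale b ε δ * Real.log (2 * k / β)

/-- The remaining rounds of the online mechanism, one for each element of the list of noise values.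
`b` is the bound `B(α)` on the number of updates, `T` the threshold, `D` the private database;
`d` is the current data structure, `C` the number of updates made so far, and `h` the list of the
(query, answer) pairs released so far, from which `A` computes the next query.
The result is the complete list of released (query, answer) pairs. -/
def run {X R : Type*} [Fintype X] {𝒬 : Set (X → ℝ)} (U : UpdateRule 𝒬 R) (b T : ℝ)
    (D : Database X) (A : List (𝒬 × ℝ) → 𝒬) :
    List ℝ → R → ℕ → List (𝒬 × ℝ) → List (𝒬 × ℝ)
  | [], _, _, h => h
  | z :: zs, d, C, h =>
    let q : 𝒬 := A h
    let noisy : ℝ := linearValue (q : X → ℝ) D + z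
    let hyp : ℝ := U.eval q d
    if |noisy - hyp| ≤ T then
      if b ≤ (C : ℝ) then h ++ [(q, hyp)]
      else run U b T D A zs d C (h ++ [(q, hyp)])
    else
      if b ≤ ((C + 1 : ℕ) : ℝ) then h ++ [(q, noisy)]
      else run U b T D A zs (U.update d q noisy) (C + 1) (h ++ [(q, noisy)])

/-- The transcript of the `k`-round mechanism for a given noise vector. -/
def transcript {X R : Type*} [Fintype X] {𝒬 : Set (X → ℝ)} (U : UpdateRule 𝒬 R) (b T : ℝ)
    (D : Database X) (A : List (𝒬 × ℝ) → 𝒬) (k : ℕ) (z : Fin k → ℝ) : List (𝒬 × ℝ) :=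
  run U b T D A (List.ofFn z) U.init 0 []

/-- The disjoint-union σ-algebra on finite lists: a set of lists is measurable iff its part of
each length `n` is measurable in `Fin n → α`. -/
instance listMeasurableSpace {α : Type*} [MeasurableSpace α] : MeasurableSpace (List α) :=
  ⨅ n : ℕ, MeasurableSpace.map (fun v : Fin n → α => List.ofFn v) inferInstance

/-- The online query release mechanism interacting with an adversary that has private coins with
law `ρ` and computes each query from its coins and the preceding transcript. The output is the law
of the adversary's view: its coins together with the transcript. The noise values are independent,
with law `Lap(σ)`, and independent of the coins. -/
def mechanism {X R Ω : Type*} [Fintype X] {𝒬 : Set (X → ℝ)} [MeasurableSpace Ω]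
    (U : UpdateRule 𝒬 R) (B : ℝ → ℝ) (α ε δ β : ℝ) (k : ℕ)
    (ρ : Measure Ω) (A : Ω → List (𝒬 × ℝ) → 𝒬) (D : Database X) :
    Measure (Ω × List (𝒬 × ℝ)) :=
  (ρ.prod (Measure.pi fun _ : Fin k => laplace (noiseScale (B α) ε δ))).map
    fun p => (p.1, transcript U (B α) (threshold (B α) ε δ β k) D (A p.1) k p.2)

end OnlineQuery

end

/-!
Fix two adjacent databases. If `B α < 1`, the assumption on `U` forces every query to vanish
(`linearValue_eq_zero_of_lt_one`), and the output does not depend on the database. Otherwise the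
mechanism makes at most `⌈B α⌉` updates, and privacy follows from a moment bound on the likelihood
ratio in which only the updates are charged.

In one round the output reveals the noisy value, centred at `Q(D)`, only when it lies outside the
no-update interval around `Q(d)`. Passing to the adjacent database moves the centre by at most `1`,
which changes the Laplace density, and so the mass of every set, by a relative error of at most
`2 / σ`. The first order part of the `n`-th moment of the likelihood ratio cancels, as the densities have
total mass one. The second order part is at most `2 (n · 2 / σ) ^ 2` times the probability of an
update: the mass of the no-update interval changes by exactly as much as the mass of its complement.
Hence discounting updates by a factor `κ = 1 - 4 (n · 2 / σ) ^ 2` makes the moment at most one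
(`moment_likelihoodRatio_le_one`), whatever the threshold and however small the probability of an
update. In particular the number `k` of rounds does not enter.

The rounds are composed by backward induction, without densities on the space of transcripts:
writing `P`, `P'` for the two laws of the rest of the transcript, with `C` updates already made,
the bound `P S ≤ t P' S + t ^ (-m) κ ^ C / κ ^ ⌈B α⌉` for all `t > 0` at once passes from the
continuations to the current round, on replacing `t` by `t` divided by the likelihood ratio of the
round (`lintegral_round_le`, `pi_laplace_run_le`). At the start, `t = exp ε` and
`m = ⌈log (4 / δ) / ε⌉` (with `n = m + 1` above) make the error at most `δ` (`exists_moment`).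
-/

namespace OnlineQuery

/-! ### Measurability on finite lists -/

section Lists

variable {α β γ : Type*} [MeasurableSpace α] [MeasurableSpace β] [MeasurableSpace γ]

lemma measurableSet_list_iff {s : Set (List α)} :
    MeasurableSet s ↔ ∀ n, MeasurableSet ((fun v : Fin n → α => List.ofFn v) ⁻¹' s) := by
  rw [listMeasurableSpace, MeasurableSpace.measurableSet_iInf]
  rfl

lemma measurableEmbedding_ofFn (n : ℕ) :
    MeasurableEmbedding (fun v : Fin n → α => List.ofFn v) := by
  refine ⟨List.ofFn_injective, fun s hs => measurableSet_list_iff.1 hs n, fun s hs => ?_⟩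
  rw [measurableSet_list_iff]
  intro m
  rcases eq_or_ne m n with rfl | hmn
  · rwa [Set.preimage_image_eq _ List.ofFn_injective]
  · convert MeasurableSet.empty
    ext v
    simp only [Set.mem_preimage, Set.mem_image, Set.mem_empty_iff_false, iff_false]
    rintro ⟨w, -, hw⟩
    apply hmn
    simpa using (congrArg List.length hw).symm

/-- Measurability of a map with a list argument can be checked for each list length separately:
the pieces of fixed length are countably many, and each is measurably embedded. -/
lemma measurable_of_forall_ofFn {f : β × List α → γ}
    (hf : ∀ n, Measurable fun p : β × (Fin n → α) => f (p.1, List.ofFn p.2)) :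
    Measurable f := by
  intro s hs
  have key : f ⁻¹' s = ⋃ n : ℕ, Prod.map id (fun v : Fin n → α => List.ofFn v) ''
      ((fun p : β × (Fin n → α) => f (p.1, List.ofFn p.2)) ⁻¹' s) := by
    ext ⟨b, l⟩
    simp only [Set.mem_preimage, Set.mem_iUnion, Set.mem_image, Prod.exists, Prod.map_apply, id,
      Prod.mk.injEq]
    constructor
    · intro h
      exact ⟨l.length, b, l.get, by simpa using h, rfl, List.ofFn_get l⟩
    · rintro ⟨n, b', v, h, rfl, rfl⟩
      exact h
  rw [key]
  exact MeasurableSet.iUnion fun n =>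
    (MeasurableEmbedding.id.prodMap (measurableEmbedding_ofFn n)).measurableSet_image.2 (hf n hs)

lemma measurable_append_singleton :
    Measurable fun p : α × List α => p.2 ++ [p.1] := by
  refine measurable_of_forall_ofFn fun n => ?_
  have h : (fun p : α × (Fin n → α) => List.ofFn p.2 ++ [p.1])
      = fun p => List.ofFn (Fin.snoc p.2 p.1 : Fin (n + 1) → α) := by
    funext p
    rw [List.ofFn_succ']
    simp
  change Measurable fun p : α × (Fin n → α) => List.ofFn p.2 ++ [p.1]
  rw [h]
  refine (measurableEmbedding_ofFn (n + 1)).measurable.comp (measurable_pi_lambda _ fun i => ?_)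
  refine Fin.lastCases ?_ (fun j => ?_) i
  · simpa using measurable_fst
  · simpa [Function.comp_def] using (measurable_pi_apply j).comp measurable_snd

end Lists

/-! ### Measurability of the transcript -/

section Run

variable {X R Ω : Type*} [Fintype X] {𝒬 : Set (X → ℝ)}

lemma measurable_linearValue (D : Database X) :
    Measurable fun q : 𝒬 => linearValue (q : X → ℝ) D := by
  unfold linearValue
  refine Finset.measurable_sum _ fun x _ => ?_
  exact ((measurable_pi_apply x).comp measurable_subtype_coe).mul_const _

variable [MeasurableSpace R] [MeasurableSpace Ω] {U : UpdateRule 𝒬 R}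

/-- The released transcript is jointly measurable in the coins, the noise, the data structure and
the history. -/
lemma measurable_run
    (hupdate : Measurable fun p : R × 𝒬 × ℝ => U.update p.1 p.2.1 p.2.2)
    (heval : Measurable fun p : 𝒬 × R => U.eval p.1 p.2)
    {A : Ω → List (𝒬 × ℝ) → 𝒬} (hA : Measurable fun p : Ω × List (𝒬 × ℝ) => A p.1 p.2)
    (b T : ℝ) (D : Database X) (n : ℕ) : ∀ C : ℕ,
    Measurable fun p : Ω × (Fin n → ℝ) × R × List (𝒬 × ℝ) =>
      run U b T D (A p.1) (List.ofFn p.2.1) p.2.2.1 C p.2.2.2 := by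
  induction n with
  | zero =>
    intro C
    simp only [List.ofFn_zero, run]
    exact measurable_snd.snd.snd
  | succ n ih =>
    intro C
    simp only [List.ofFn_succ, run]
    have hω : Measurable fun p : Ω × (Fin (n + 1) → ℝ) × R × List (𝒬 × ℝ) => p.1 := measurable_fst
    have hz : Measurable fun p : Ω × (Fin (n + 1) → ℝ) × R × List (𝒬 × ℝ) => p.2.1 0 :=
      (measurable_pi_apply 0).comp measurable_snd.fst
    have hzs : Measurable fun p : Ω × (Fin (n + 1) → ℝ) × R × List (𝒬 × ℝ) =>
        fun i : Fin n => p.2.1 i.succ :=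
      measurable_pi_lambda _ fun i => (measurable_pi_apply i.succ).comp measurable_snd.fst
    have hd : Measurable fun p : Ω × (Fin (n + 1) → ℝ) × R × List (𝒬 × ℝ) => p.2.2.1 :=
      measurable_snd.snd.fst
    have hh : Measurable fun p : Ω × (Fin (n + 1) → ℝ) × R × List (𝒬 × ℝ) => p.2.2.2 :=
      measurable_snd.snd.snd
    have hq : Measurable fun p : Ω × (Fin (n + 1) → ℝ) × R × List (𝒬 × ℝ) => A p.1 p.2.2.2 :=
      hA.comp (hω.prodMk hh)
    have hhyp : Measurable fun p : Ω × (Fin (n + 1) → ℝ) × R × List (𝒬 × ℝ) =>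
        U.eval (A p.1 p.2.2.2) p.2.2.1 := heval.comp (hq.prodMk hd)
    have hnoisy : Measurable fun p : Ω × (Fin (n + 1) → ℝ) × R × List (𝒬 × ℝ) =>
        linearValue (A p.1 p.2.2.2 : X → ℝ) D + p.2.1 0 :=
      ((measurable_linearValue D).comp hq).add hz
    have hh₁ := measurable_append_singleton.comp ((hq.prodMk hhyp).prodMk hh)
    have hh₂ := measurable_append_singleton.comp ((hq.prodMk hnoisy).prodMk hh)
    have hd' := hupdate.comp (hd.prodMk (hq.prodMk hnoisy))
    refine Measurable.ite ?_ ?_ ?_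
    · exact measurableSet_le (continuous_abs.measurable.comp (hnoisy.sub hhyp)) measurable_const
    · exact Measurable.ite (MeasurableSet.const _) hh₁
        ((ih C).comp (hω.prodMk (hzs.prodMk (hd.prodMk hh₁))))
    · exact Measurable.ite (MeasurableSet.const _) hh₂
        ((ih (C + 1)).comp (hω.prodMk (hzs.prodMk (hd'.prodMk hh₂))))

end Run

/-! ### The Laplace distribution -/

/-- The density of the Laplace distribution with scale `σ` centred at `0`. -/
noncomputable def laplaceDensity (σ x : ℝ) : ℝ := 1 / (2 * σ) * Real.exp (-(|x| / σ))

section Laplace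

variable {σ : ℝ}

lemma laplaceDensity_pos (hσ : 0 < σ) (x : ℝ) : 0 < laplaceDensity σ x := by
  unfold laplaceDensity; positivity

@[fun_prop]
lemma measurable_laplaceDensity : Measurable (laplaceDensity σ) := by
  unfold laplaceDensity; fun_prop

lemma integral_laplaceDensity (hσ : 0 < σ) : ∫ x, laplaceDensity σ x = 1 := by
  unfold laplaceDensity
  rw [integral_const_mul, integral_comp_abs (f := fun x => Real.exp (-(x / σ)))]
  have h := integral_exp_mul_Ioi (a := -σ⁻¹) (by simpa using hσ) 0
  have e : (fun x : ℝ => Real.exp (-(x / σ))) = fun x => Real.exp (-σ⁻¹ * x) := by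
    funext x; congr 1; ring
  rw [e, h]
  simp
  field_simp

lemma integrable_laplaceDensity (hσ : 0 < σ) : Integrable (laplaceDensity σ) := by
  by_contra h
  have h1 := integral_laplaceDensity hσ
  rw [integral_undef h] at h1
  exact zero_ne_one h1

lemma isProbabilityMeasure_laplace (hσ : 0 < σ) : IsProbabilityMeasure (laplace σ) := by
  constructor
  rw [laplace, withDensity_apply _ MeasurableSet.univ, Measure.restrict_univ]
  change ∫⁻ x, ENNReal.ofReal (laplaceDensity σ x) = 1
  rw [← ofReal_integral_eq_lintegral_ofReal (integrable_laplaceDensity hσ)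
    (Filter.Eventually.of_forall fun x => (laplaceDensity_pos hσ x).le),
    integral_laplaceDensity hσ, ENNReal.ofReal_one]

/-- Shifting the Laplace distribution by `m` shifts its density. -/
lemma lintegral_laplace_add (m : ℝ) (G : ℝ → ENNReal) :
    ∫⁻ z, G (m + z) ∂laplace σ = ∫⁻ w, ENNReal.ofReal (laplaceDensity σ (w - m)) * G w := by
  have hm : Measurable fun x => ENNReal.ofReal (laplaceDensity σ x) :=
    measurable_laplaceDensity.ennreal_ofReal
  rw [laplace]
  change ∫⁻ z, G (m + z) ∂volume.withDensity (fun x => ENNReal.ofReal (laplaceDensity σ x)) = _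
  rw [lintegral_withDensity_eq_lintegral_mul_non_measurable _ hm
    (Filter.Eventually.of_forall fun x => ENNReal.ofReal_lt_top)]
  rw [← lintegral_add_left_eq_self
    (fun w => ENNReal.ofReal (laplaceDensity σ (w - m)) * G w) m]
  simp

/-- Shifting the centre by at most `1` changes the Laplace density by a relative error of at most
`2 / σ`. -/
lemma abs_laplaceDensity_sub_le (hσ : 1 ≤ σ) {x y : ℝ} (hxy : |x - y| ≤ 1) :
    |laplaceDensity σ x - laplaceDensity σ y| ≤ 2 / σ * laplaceDensity σ y := by
  have hσ0 : 0 < σ := by linarith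
  set v : ℝ := |y| / σ - |x| / σ with hv
  have hfac : laplaceDensity σ x = Real.exp v * laplaceDensity σ y := by
    unfold laplaceDensity
    rw [mul_left_comm, ← Real.exp_add]
    congr 2
    rw [hv]; ring
  have hvabs : |v| ≤ 1 / σ := by
    rw [hv, ← sub_div, abs_div, abs_of_pos hσ0]
    gcongr
    exact (abs_abs_sub_abs_le y x).trans (by rwa [abs_sub_comm])
  have h1 : |v| ≤ 1 := hvabs.trans (by rw [div_le_one hσ0]; exact hσ)
  have h2 : |Real.exp v - 1| ≤ 2 * |v| := Real.abs_exp_sub_one_le h1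
  rw [hfac, ← sub_one_mul, abs_mul, abs_of_pos (laplaceDensity_pos hσ0 y)]
  refine mul_le_mul_of_nonneg_right ?_ (laplaceDensity_pos hσ0 y).le
  calc |Real.exp v - 1| ≤ 2 * |v| := h2
    _ ≤ 2 * (1 / σ) := by gcongr
    _ = 2 / σ := by ring

end Laplace

/-! ### A moment bound for one round -/

/-- A second order upper bound for `y (x / y) ^ n` when `x` and `y` have relative distance at most
`s ≤ 1 / n`. -/
lemma mul_div_pow_le {x y s : ℝ} {n : ℕ} (hx : 0 ≤ x) (hy : 0 < y) (hxy : |x - y| ≤ s * y)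
    (hs : n * s ≤ 1) :
    y * (x / y) ^ n ≤ y + n * (x - y) + n ^ 2 * s * |x - y| := by
  set r : ℝ := (x - y) / y with hr
  have hxr : x / y = 1 + r := by rw [hr]; field_simp; ring
  have hn : (0 : ℝ) ≤ n := n.cast_nonneg
  have hyr : y * r = x - y := by rw [hr]; field_simp
  have hyr' : y * |r| = |x - y| := by rw [← abs_of_pos hy, ← abs_mul, abs_of_pos hy, hyr]
  have hrs : |r| ≤ s := by
    rw [← hyr', mul_comm] at hxy
    exact le_of_mul_le_mul_right hxy hy
  have hnr : |n * r| ≤ 1 := by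
    rw [abs_mul, abs_of_nonneg hn]
    exact (mul_le_mul_of_nonneg_left hrs hn).trans hs
  have h1 : (1 + r) ^ n ≤ 1 + n * r + (n * r) ^ 2 := by
    calc (1 + r) ^ n ≤ Real.exp r ^ n := by
          refine pow_le_pow_left₀ (hxr ▸ by positivity) ?_ n
          linarith [Real.add_one_le_exp r]
      _ = Real.exp (n * r) := by rw [← Real.exp_nat_mul]
      _ ≤ 1 + n * r + (n * r) ^ 2 := by
          have := (abs_le.1 (Real.abs_exp_sub_one_sub_id_le hnr)).2
          linarith
  rw [hxr]
  calc y * (1 + r) ^ n ≤ y * (1 + n * r + (n * r) ^ 2) := by gcongr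
    _ = y + n * (y * r) + n ^ 2 * (y * |r|) * |r| := by
      rw [mul_assoc, mul_assoc, abs_mul_abs_self]; ring
    _ ≤ y + n * (y * r) + n ^ 2 * (y * |r|) * s := by gcongr
    _ = _ := by rw [hyr, hyr']; ring

/-- Bernoulli's inequality for `y (x / y) ^ n`. -/
lemma le_mul_div_pow {x y s : ℝ} {n : ℕ} (hy : 0 < y) (hxy : |x - y| ≤ s * y)
    (hx : 0 ≤ x) (hs : n * s ≤ 1 / 2) : y / 2 ≤ y * (x / y) ^ n := by
  set r : ℝ := (x - y) / y with hr
  have hxr : x / y = 1 + r := by rw [hr]; field_simp; ring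
  have hn : (0 : ℝ) ≤ n := n.cast_nonneg
  have hrs : -s ≤ r := by
    rw [hr, le_div_iff₀ hy]; linarith [(abs_le.1 hxy).1]
  have hr1 : -2 ≤ r := by
    have : 0 ≤ 1 + r := hxr ▸ by positivity
    linarith
  have h1 := one_add_mul_le_pow hr1 n
  have h2 : (n : ℝ) * -s ≤ n * r := mul_le_mul_of_nonneg_left hrs hn
  rw [hxr]
  calc y / 2 = y * (1 / 2) := by ring
    _ ≤ y * (1 + r) ^ n := by gcongr; linarith

section Round

variable {σ m m' : ℝ}

lemma integrable_laplaceDensity_sub (hσ : 0 < σ) (m : ℝ) :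
    Integrable fun w => laplaceDensity σ (w - m) :=
  (integrable_laplaceDensity hσ).comp_sub_right m

lemma integral_laplaceDensity_sub (hσ : 0 < σ) (m : ℝ) :
    ∫ w, laplaceDensity σ (w - m) = 1 := by
  rw [integral_sub_right_eq_self (fun w => laplaceDensity σ w) m, integral_laplaceDensity hσ]

lemma abs_laplaceDensity_sub_sub_le (hσ : 1 ≤ σ) (hm : |m - m'| ≤ 1) (w : ℝ) :
    |laplaceDensity σ (w - m) - laplaceDensity σ (w - m')|
      ≤ 2 / σ * laplaceDensity σ (w - m') := by
  refine abs_laplaceDensity_sub_le hσ ?_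
  rw [abs_sub_comm] at hm
  convert hm using 2
  ring

/-- Shifting the centre by at most `1` changes the Laplace mass of any set by a relative error of at
most `2 / σ`. -/
lemma abs_setIntegral_laplaceDensity_sub_le (hσ : 1 ≤ σ) (hm : |m - m'| ≤ 1) (s : Set ℝ) :
    |(∫ w in s, laplaceDensity σ (w - m)) - ∫ w in s, laplaceDensity σ (w - m')|
      ≤ 2 / σ * ∫ w in s, laplaceDensity σ (w - m') := by
  have hσ0 : 0 < σ := by linarith
  have hi := (integrable_laplaceDensity_sub hσ0 m).integrableOn (s := s)
  have hi' := (integrable_laplaceDensity_sub hσ0 m').integrableOn (s := s)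
  rw [← integral_sub hi hi', ← integral_const_mul]
  refine (abs_integral_le_integral_abs).trans ?_
  exact integral_mono (hi.sub hi').abs (hi'.const_mul _)
    fun w => abs_laplaceDensity_sub_sub_le hσ hm w

lemma integrable_mul_div_pow (hσ : 1 ≤ σ) (hm : |m - m'| ≤ 1) {n : ℕ}
    (hn : n * (2 / σ) ≤ 1 / 2) :
    Integrable fun w => laplaceDensity σ (w - m') *
      (laplaceDensity σ (w - m) / laplaceDensity σ (w - m')) ^ n := by
  have hσ0 : 0 < σ := by linarith
  have hi := integrable_laplaceDensity_sub hσ0 m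
  have hi' := integrable_laplaceDensity_sub hσ0 m'
  refine Integrable.mono' ((hi'.add ((hi.sub hi').const_mul n)).add
    ((hi.sub hi').abs.const_mul (n ^ 2 * (2 / σ)))) ?_ (Filter.Eventually.of_forall fun w => ?_)
  · exact Measurable.aestronglyMeasurable (by fun_prop)
  · have h' := laplaceDensity_pos hσ0 (w - m')
    have h := laplaceDensity_pos hσ0 (w - m)
    rw [Real.norm_of_nonneg (by positivity)]
    exact mul_div_pow_le h.le h' (abs_laplaceDensity_sub_sub_le hσ hm w) (by linarith)

/-- A round whose output reveals only membership of the noisy value `w` in `I` when `w ∈ I`, and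
reveals `w` otherwise. If the second kind of outcome is discounted by the factor
`1 - 4 (n · 2 / σ) ^ 2`, the `n`-th moment of the likelihood ratio of two such rounds with centres
at distance at most `1` is at most `1`. The reason is that the second order part of the moment
is controlled by the mass `u'` of `Iᶜ`: on `I` the mass changes by as much as on `Iᶜ`. -/
lemma moment_likelihoodRatio_le_one (hσ : 1 ≤ σ) (hm : |m - m'| ≤ 1) {n : ℕ} (hn0 : n ≠ 0)
    (hn : n * (2 / σ) ≤ 1 / 2) {I : Set ℝ} (hI : MeasurableSet I) {κ : ℝ}
    (hκ : κ = 1 - 4 * (n * (2 / σ)) ^ 2) :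
    (∫ w in I, laplaceDensity σ (w - m')) *
        ((∫ w in I, laplaceDensity σ (w - m)) / ∫ w in I, laplaceDensity σ (w - m')) ^ n
      + κ * ∫ w in Iᶜ, laplaceDensity σ (w - m') *
        (laplaceDensity σ (w - m) / laplaceDensity σ (w - m')) ^ n ≤ 1 := by
  have hσ0 : 0 < σ := by linarith
  have hi := integrable_laplaceDensity_sub hσ0 m
  have hi' := integrable_laplaceDensity_sub hσ0 m'
  have hJ := integrable_mul_div_pow hσ hm hn
  have hpos := fun w => laplaceDensity_pos hσ0 (w - m)
  have hpos' := fun w => laplaceDensity_pos hσ0 (w - m')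
  have hclose := abs_laplaceDensity_sub_sub_le hσ hm
  have hpu := integral_add_compl hI hi
  have hpu' := integral_add_compl hI hi'
  rw [integral_laplaceDensity_sub hσ0] at hpu hpu'
  have hp := abs_setIntegral_laplaceDensity_sub_le hσ hm I
  have hu := abs_setIntegral_laplaceDensity_sub_le hσ hm Iᶜ
  have hp0 : 0 ≤ ∫ w in I, laplaceDensity σ (w - m) := integral_nonneg fun w => (hpos w).le
  have hp0' : 0 ≤ ∫ w in I, laplaceDensity σ (w - m') := integral_nonneg fun w => (hpos' w).le
  have hJle : ∫ w in Iᶜ, laplaceDensity σ (w - m') *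
        (laplaceDensity σ (w - m) / laplaceDensity σ (w - m')) ^ n
      ≤ ∫ w in Iᶜ, (laplaceDensity σ (w - m')
        + n * (laplaceDensity σ (w - m) - laplaceDensity σ (w - m'))
        + n ^ 2 * (2 / σ) * (2 / σ * laplaceDensity σ (w - m'))) := by
    refine integral_mono hJ.integrableOn
      ((hi'.add ((hi.sub hi').const_mul n)).add ((hi'.const_mul _).const_mul _)).integrableOn
      fun w => ?_
    refine (mul_div_pow_le (hpos w).le (hpos' w) (hclose w) (by linarith)).trans ?_
    have := mul_le_mul_of_nonneg_left (hclose w) (show 0 ≤ (n : ℝ) ^ 2 * (2 / σ) by positivity)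
    simpa using this
  have hJge : (∫ w in Iᶜ, laplaceDensity σ (w - m')) / 2 ≤ ∫ w in Iᶜ, laplaceDensity σ (w - m') *
        (laplaceDensity σ (w - m) / laplaceDensity σ (w - m')) ^ n := by
    rw [← integral_div]
    exact integral_mono (hi'.div_const 2).integrableOn hJ.integrableOn
      fun w => le_mul_div_pow (hpos' w) (hclose w) (hpos w).le hn
  have i1 := hi.integrableOn (s := Iᶜ)
  have i2 := hi'.integrableOn (s := Iᶜ)
  have i3 : IntegrableOn (fun w =>
      n * (laplaceDensity σ (w - m) - laplaceDensity σ (w - m'))) Iᶜ := (i1.sub i2).const_mul _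
  have i4 : IntegrableOn (fun w => laplaceDensity σ (w - m')
      + n * (laplaceDensity σ (w - m) - laplaceDensity σ (w - m'))) Iᶜ := i2.add i3
  rw [integral_add i4 ((i2.const_mul _).const_mul _),
    integral_add i2 i3, integral_const_mul, integral_sub i1 i2,
    integral_const_mul, integral_const_mul] at hJle
  generalize (∫ w in Iᶜ, laplaceDensity σ (w - m') *
        (laplaceDensity σ (w - m) / laplaceDensity σ (w - m')) ^ n) = J at *
  generalize (∫ w in I, laplaceDensity σ (w - m)) = p at *
  generalize (∫ w in I, laplaceDensity σ (w - m')) = p' at *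
  generalize (∫ w in Iᶜ, laplaceDensity σ (w - m)) = u at *
  generalize (∫ w in Iᶜ, laplaceDensity σ (w - m')) = u' at *
  have hpp : |p - p'| = |u - u'| := by
    rw [← abs_neg]; congr 1; linarith
  have hP : p' * (p / p') ^ n ≤ p' + n * (p - p') + n ^ 2 * (2 / σ) * |p - p'| := by
    rcases hp0'.eq_or_lt with h0 | h0
    · have : p = 0 := by
        rw [← h0] at hp
        simpa using hp
      simp [← h0, this]
    · exact mul_div_pow_le hp0 h0 hp (by linarith)
  have h2 : (n : ℝ) ^ 2 * (2 / σ) * |p - p'| ≤ n ^ 2 * (2 / σ) * (2 / σ * u') := by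
    rw [hpp]; gcongr
  have h3 : 4 * (n * (2 / σ)) ^ 2 * (u' / 2) ≤ 4 * (n * (2 / σ)) ^ 2 * J := by gcongr
  have h4 : (n : ℝ) * (p - p') + n * (u - u') = 0 := by
    have : u - u' = -(p - p') := by linarith
    rw [this]; ring
  rw [hκ]
  nlinarith

/-- Rescaling a bound that holds for all multipliers `t` by the ratio of two masses. -/
lemma ofReal_mul_le_of_forall {V V' : ENNReal} {k : ℕ} {K : ℝ}
    (hV : ∀ t : ℝ, 0 < t → V ≤ ENNReal.ofReal t * V' + ENNReal.ofReal ((1 / t) ^ k * K))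
    {x y t : ℝ} (hx : 0 < x) (hy : 0 < y) (ht : 0 < t) :
    ENNReal.ofReal x * V ≤ ENNReal.ofReal t * (ENNReal.ofReal y * V')
      + ENNReal.ofReal ((1 / t) ^ k * K * (y * (x / y) ^ (k + 1))) := by
  refine (mul_le_mul_right (hV (t * y / x) (by positivity)) (ENNReal.ofReal x)).trans ?_
  rw [mul_add, ← mul_assoc, ← mul_assoc, ← ENNReal.ofReal_mul hx.le, ← ENNReal.ofReal_mul ht.le,
    ← ENNReal.ofReal_mul hx.le]
  have h1 : x * (t * y / x) = t * y := by field_simp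
  have h2 : 1 / (t * y / x) = 1 / t * (x / y) := by field_simp
  have h3 : x * ((1 / (t * y / x)) ^ k * K) = (1 / t) ^ k * K * (y * (x / y) ^ (k + 1)) := by
    have h4 : y * (x / y) = x := by field_simp
    rw [h2, mul_pow, pow_succ]
    linear_combination (-(1 / t) ^ k * K * (x / y) ^ k) * h4
  rw [h1, h3]

/-- One round of the composition argument. The continuation probabilities are `V`, `V'` after a
round without update and `W w`, `W' w` after an update with noisy value `w`; the admissible error
shrinks by the factor `κ` at an update. -/
lemma lintegral_round_le (hσ : 1 ≤ σ) (hm : |m - m'| ≤ 1) {k : ℕ}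
    (hk : ((k + 1 : ℕ) : ℝ) * (2 / σ) ≤ 1 / 2) {I : Set ℝ} (hI : MeasurableSet I)
    {V V' : ENNReal} {W W' : ℝ → ENNReal} {κ K : ℝ}
    (hκ : κ = 1 - 4 * (((k + 1 : ℕ) : ℝ) * (2 / σ)) ^ 2) (hK : 0 ≤ K)
    (hV : ∀ t : ℝ, 0 < t → V ≤ ENNReal.ofReal t * V' + ENNReal.ofReal ((1 / t) ^ k * K))
    (hW : ∀ w, ∀ t : ℝ, 0 < t →
      W w ≤ ENNReal.ofReal t * W' w + ENNReal.ofReal ((1 / t) ^ k * (K * κ)))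
    {G G' : ℝ → ENNReal} (hG : ∀ w ∈ I, G w = V) (hG' : ∀ w ∈ I, G' w = V')
    (hGc : ∀ w ∈ Iᶜ, G w = W w) (hGc' : ∀ w ∈ Iᶜ, G' w = W' w) {t : ℝ} (ht : 0 < t) :
    ∫⁻ z, G (m + z) ∂laplace σ ≤ ENNReal.ofReal t * (∫⁻ z, G' (m' + z) ∂laplace σ)
      + ENNReal.ofReal ((1 / t) ^ k * K) := by
  have hσ0 : 0 < σ := by linarith
  have hpos := fun w => laplaceDensity_pos hσ0 (w - m)
  have hpos' := fun w => laplaceDensity_pos hσ0 (w - m')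
  have hκ0 : 0 ≤ κ := by
    have : (((k + 1 : ℕ) : ℝ) * (2 / σ)) ^ 2 ≤ (1 / 2) ^ 2 := by gcongr
    rw [hκ]; linarith
  have hmass : ∀ m₀ : ℝ, ∫⁻ w in I, ENNReal.ofReal (laplaceDensity σ (w - m₀))
      = ENNReal.ofReal (∫ w in I, laplaceDensity σ (w - m₀)) := fun m₀ =>
    (ofReal_integral_eq_lintegral_ofReal (integrable_laplaceDensity_sub hσ0 m₀).integrableOn
      (Filter.Eventually.of_forall fun w => (laplaceDensity_pos hσ0 (w - m₀)).le)).symm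
  have hmeas : ∀ m₀ : ℝ, Measurable fun w => ENNReal.ofReal (laplaceDensity σ (w - m₀)) :=
    fun m₀ => (measurable_laplaceDensity.comp (measurable_id.sub_const m₀)).ennreal_ofReal
  have hsplit : ∀ (m₀ : ℝ) (H : ℝ → ENNReal) (v : ENNReal) (ω : ℝ → ENNReal), (∀ w ∈ I, H w = v) →
      (∀ w ∈ Iᶜ, H w = ω w) → ∫⁻ z, H (m₀ + z) ∂laplace σ =
        ENNReal.ofReal (∫ w in I, laplaceDensity σ (w - m₀)) * v
          + ∫⁻ w in Iᶜ, ENNReal.ofReal (laplaceDensity σ (w - m₀)) * ω w := by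
    intro m₀ H v ω h1 h2
    rw [lintegral_laplace_add, ← lintegral_add_compl _ hI]
    congr 1
    · rw [← hmass, ← lintegral_mul_const _ (hmeas m₀)]
      exact setLIntegral_congr_fun hI fun w hw => by simp only [h1 w hw]
    · exact setLIntegral_congr_fun hI.compl fun w hw => by simp only [h2 w hw]
  rw [hsplit m G V W hG hGc, hsplit m' G' V' W' hG' hGc']
  have hp := abs_setIntegral_laplaceDensity_sub_le hσ hm I
  have hp0 : 0 ≤ ∫ w in I, laplaceDensity σ (w - m) := integral_nonneg fun w => (hpos w).le
  have hp0' : 0 ≤ ∫ w in I, laplaceDensity σ (w - m') := integral_nonneg fun w => (hpos' w).le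
  have hmoment := moment_likelihoodRatio_le_one hσ hm (Nat.add_one_ne_zero k) hk hI hκ
  have hJ := (integrable_mul_div_pow hσ hm hk).integrableOn (s := Iᶜ)
  have hJnn : ∀ w, 0 ≤ laplaceDensity σ (w - m') *
      (laplaceDensity σ (w - m) / laplaceDensity σ (w - m')) ^ (k + 1) := fun w => by
    have := hpos w
    have := hpos' w
    positivity
  have hupd : ∫⁻ w in Iᶜ, ENNReal.ofReal (laplaceDensity σ (w - m)) * W w
      ≤ ENNReal.ofReal t * (∫⁻ w in Iᶜ, ENNReal.ofReal (laplaceDensity σ (w - m')) * W' w)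
        + ENNReal.ofReal ((1 / t) ^ k * (K * κ) * ∫ w in Iᶜ, laplaceDensity σ (w - m') *
          (laplaceDensity σ (w - m) / laplaceDensity σ (w - m')) ^ (k + 1)) := by
    have hc : (0 : ℝ) ≤ (1 / t) ^ k * (K * κ) := by positivity
    rw [← integral_const_mul, ofReal_integral_eq_lintegral_ofReal (hJ.const_mul _)
      (Filter.Eventually.of_forall fun w => mul_nonneg hc (hJnn w)),
      ← lintegral_const_mul' _ _ ENNReal.ofReal_ne_top, ← lintegral_add_right _ (by fun_prop)]
    exact lintegral_mono fun w => ofReal_mul_le_of_forall (hW w) (hpos w) (hpos' w) ht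
  have hno : ENNReal.ofReal (∫ w in I, laplaceDensity σ (w - m)) * V
      ≤ ENNReal.ofReal t * (ENNReal.ofReal (∫ w in I, laplaceDensity σ (w - m')) * V')
        + ENNReal.ofReal ((1 / t) ^ k * K * ((∫ w in I, laplaceDensity σ (w - m')) *
          ((∫ w in I, laplaceDensity σ (w - m)) / ∫ w in I, laplaceDensity σ (w - m'))
            ^ (k + 1))) := by
    rcases hp0.eq_or_lt with h0 | h0
    · simp [← h0]
    · refine ofReal_mul_le_of_forall hV h0 (hp0'.lt_of_ne fun h => ?_) ht
      rw [← h, mul_zero, sub_zero] at hp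
      exact absurd (abs_nonpos_iff.1 hp) h0.ne'
  refine (add_le_add hno hupd).trans ?_
  rw [add_add_add_comm, ← mul_add]
  gcongr
  rw [← ENNReal.ofReal_add (by positivity)
    (mul_nonneg (by positivity) (integral_nonneg fun w => hJnn w))]
  refine ENNReal.ofReal_le_ofReal ?_
  have := mul_le_mul_of_nonneg_left hmoment (show 0 ≤ (1 / t) ^ k * K by positivity)
  refine (le_of_eq ?_).trans (this.trans_eq (mul_one _))
  ring

end Round

/-! ### Composition over the rounds -/

section Composition

variable {X R Ω : Type*} [Fintype X] [MeasurableSpace R] [MeasurableSpace Ω] {𝒬 : Set (X → ℝ)}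
  {U : UpdateRule 𝒬 R} {A : Ω → List (𝒬 × ℝ) → 𝒬}

/-- The probability that the remaining `n` rounds lead to a transcript in `S`, obtained by
integrating over the noise of the first of them. -/
lemma pi_laplace_run_succ
    (hupdate : Measurable fun p : R × 𝒬 × ℝ => U.update p.1 p.2.1 p.2.2)
    (heval : Measurable fun p : 𝒬 × R => U.eval p.1 p.2)
    (hA : Measurable fun p : Ω × List (𝒬 × ℝ) => A p.1 p.2)
    {σ : ℝ} [IsProbabilityMeasure (laplace σ)] (b T : ℝ) (D : Database X) (ω : Ω) (n C : ℕ) (d : R)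
    (h : List (𝒬 × ℝ)) {S : Set (List (𝒬 × ℝ))} (hS : MeasurableSet S) :
    (Measure.pi fun _ : Fin (n + 1) => laplace σ)
        {z | run U b T D (A ω) (List.ofFn z) d C h ∈ S}
      = ∫⁻ x, (Measure.pi fun _ : Fin n => laplace σ)
        {z | run U b T D (A ω) (x :: List.ofFn z) d C h ∈ S} ∂laplace σ := by
  set e := MeasurableEquiv.piFinSuccAbove (fun _ : Fin (n + 1) => ℝ) 0
  have hmp := measurePreserving_piFinSuccAbove (fun _ : Fin (n + 1) => laplace σ) 0
  have hpre : e ⁻¹' {p : ℝ × (Fin n → ℝ) | run U b T D (A ω) (p.1 :: List.ofFn p.2) d C h ∈ S}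
      = {z | run U b T D (A ω) (List.ofFn z) d C h ∈ S} := by
    ext z
    rw [Set.mem_preimage, Set.mem_ofPred_eq, Set.mem_ofPred_eq, List.ofFn_succ]
    rfl
  have hmeas : MeasurableSet {z : Fin (n + 1) → ℝ |
      run U b T D (A ω) (List.ofFn z) d C h ∈ S} :=
    ((measurable_run hupdate heval hA b T D (n + 1) C).comp
      ((measurable_const (a := ω)).prodMk (measurable_id.prodMk (measurable_const (a := (d, h))))) :
        Measurable fun z : Fin (n + 1) → ℝ => run U b T D (A ω) (List.ofFn z) d C h) hS
  rw [← hpre] at hmeas ⊢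
  rw [hmp.measure_preimage_equiv, Measure.prod_apply (e.measurableSet_preimage.1 hmeas)]
  rfl

/-- The privacy invariant of the composition. For every multiplier `t` the probability of `S` under
`D` is at most `t` times that under `D'`, up to an error `t ^ (-m)` that carries a factor
`κ⁻¹` for each update still possible. Here `t = exp (ε - ℓ)` corresponds to a privacy loss `ℓ`
already incurred, and the error is the Markov bound for the `m`-th moment of the
likelihood ratio. -/
lemma pi_laplace_run_le
    (hupdate : Measurable fun p : R × 𝒬 × ℝ => U.update p.1 p.2.1 p.2.2)
    (heval : Measurable fun p : 𝒬 × R => U.eval p.1 p.2)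
    (hA : Measurable fun p : Ω × List (𝒬 × ℝ) => A p.1 p.2)
    {σ κ b : ℝ} (hσ : 1 ≤ σ) (T : ℝ) {D D' : Database X}
    (hD : ∀ q ∈ 𝒬, |linearValue q D - linearValue q D'| ≤ 1) {m : ℕ}
    (hm : ((m + 1 : ℕ) : ℝ) * (2 / σ) ≤ 1 / 2)
    (hκ : κ = 1 - 4 * (((m + 1 : ℕ) : ℝ) * (2 / σ)) ^ 2) (hκ0 : 0 < κ)
    (ω : Ω) {S : Set (List (𝒬 × ℝ))} (hS : MeasurableSet S) (n : ℕ) :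
    ∀ (C : ℕ) (d : R) (h : List (𝒬 × ℝ)), (C : ℝ) < b → ∀ t : ℝ, 0 < t →
      (Measure.pi fun _ : Fin n => laplace σ) {z | run U b T D (A ω) (List.ofFn z) d C h ∈ S}
        ≤ ENNReal.ofReal t * (Measure.pi fun _ : Fin n => laplace σ)
            {z | run U b T D' (A ω) (List.ofFn z) d C h ∈ S}
          + ENNReal.ofReal ((1 / t) ^ m * (κ ^ C / κ ^ ⌈b⌉₊)) := by
  have hprob : IsProbabilityMeasure (laplace σ) :=
    isProbabilityMeasure_laplace (by linarith)
  have hκ1 : κ ≤ 1 := by rw [hκ]; nlinarith [sq_nonneg (((m + 1 : ℕ) : ℝ) * (2 / σ))]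
  -- After termination the two transcripts agree, so the bound is trivial: `t` or `1 / t` is `≥ 1`.
  have hterminated : ∀ (n C : ℕ) (l : List (𝒬 × ℝ)), C ≤ ⌈b⌉₊ → ∀ t : ℝ, 0 < t →
      (Measure.pi fun _ : Fin n => laplace σ) {_z | l ∈ S}
        ≤ ENNReal.ofReal t * (Measure.pi fun _ : Fin n => laplace σ) {_z | l ∈ S}
          + ENNReal.ofReal ((1 / t) ^ m * (κ ^ C / κ ^ ⌈b⌉₊)) := by
    intro n C l hC t ht
    rcases le_total 1 t with h1 | h1
    · refine le_add_right (le_mul_of_one_le_left' ?_)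
      simpa using ENNReal.ofReal_le_ofReal h1
    · refine le_add_left (prob_le_one.trans ?_)
      rw [ENNReal.one_le_ofReal]
      refine one_le_mul_of_one_le_of_one_le (one_le_pow₀ ?_) ?_
      · rwa [le_div_iff₀ ht, one_mul]
      · rw [le_div_iff₀ (by positivity), one_mul]
        exact pow_le_pow_of_le_one hκ0.le hκ1 hC
  induction n with
  | zero =>
    intro C d h hC t ht
    simp only [List.ofFn_zero, run]
    exact hterminated 0 C h (Nat.lt_ceil.2 hC).le t ht
  | succ n ih =>
    intro C d h hC t ht
    have hC' : C + 1 ≤ ⌈b⌉₊ := Nat.lt_ceil.2 hC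
    rw [pi_laplace_run_succ hupdate heval hA b T D ω n C d h hS,
      pi_laplace_run_succ hupdate heval hA b T D' ω n C d h hS]
    -- The continuation probability as a function of the noisy value `w`.
    let W : Database X → ℝ → ENNReal := fun E w =>
      if b ≤ ((C + 1 : ℕ) : ℝ) then
        (Measure.pi fun _ : Fin n => laplace σ) {_z | h ++ [(A ω h, w)] ∈ S}
      else (Measure.pi fun _ : Fin n => laplace σ)
        {z | run U b T E (A ω) (List.ofFn z) (U.update d (A ω h) w) (C + 1) (h ++ [(A ω h, w)]) ∈ S}
    let V : Database X → ENNReal := fun E => (Measure.pi fun _ : Fin n => laplace σ)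
        {z | run U b T E (A ω) (List.ofFn z) d C (h ++ [(A ω h, U.eval (A ω h) d)]) ∈ S}
    let G : Database X → ℝ → ENNReal := fun E w =>
      if |w - U.eval (A ω h) d| ≤ T then V E else W E w
    have hrun : ∀ (E : Database X) (x : ℝ), (Measure.pi fun _ : Fin n => laplace σ)
        {z | run U b T E (A ω) (x :: List.ofFn z) d C h ∈ S}
          = G E (linearValue (A ω h : X → ℝ) E + x) := by
      intro E x
      simp only [run, G, V, W, if_neg (not_le.2 hC)]
      split_ifs <;> rfl
    simp only [hrun]
    have hI : MeasurableSet {w : ℝ | |w - U.eval (A ω h) d| ≤ T} :=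
      measurableSet_le (by fun_prop) measurable_const
    refine lintegral_round_le hσ (hD _ (A ω h).2) hm hI (V := V D) (V' := V D') (W := W D)
      (W' := W D') hκ (by positivity) (ih C d _ hC) ?_ (fun w hw => if_pos hw)
      (fun w hw => if_pos hw) (fun w hw => if_neg hw) (fun w hw => if_neg hw) ht
    intro w s hs
    have hK : κ ^ C / κ ^ ⌈b⌉₊ * κ = κ ^ (C + 1) / κ ^ ⌈b⌉₊ := by rw [pow_succ]; ring
    rw [hK]
    simp only [W]
    split_ifs with hb
    · exact hterminated n (C + 1) _ hC' s hs
    · exact ih (C + 1) _ _ (not_le.1 hb) s hs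

end Composition

/-! ### Sensitivity of the queries and the degenerate case -/

section Queries

variable {X R : Type*} [Fintype X] {𝒬 : Set (X → ℝ)} {U : UpdateRule 𝒬 R}

lemma abs_linearValue_sub_le_one {Q : X → ℝ} (hQ : ∀ x, Q x ∈ Set.Icc (0 : ℝ) 1)
    {D D' : Database X} (hD : Adjacent D D') : |linearValue Q D - linearValue Q D'| ≤ 1 := by
  unfold linearValue
  rw [← Finset.sum_sub_distrib]
  refine (Finset.abs_sum_le_sum_abs _ _).trans (le_trans (Finset.sum_le_sum fun x _ => ?_) hD)
  rw [← mul_sub, abs_mul, abs_of_nonneg (hQ x).1]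
  exact mul_le_of_le_one_left (abs_nonneg _) (hQ x).2

/-- If no database update sequence has length one, all queries vanish: a query with positive value
on some database is unbounded over the databases, so some database is at distance at least `α`
from the initial structure. -/
lemma linearValue_eq_zero_of_lt_one (h𝒬 : ∀ Q ∈ 𝒬, ∀ x, Q x ∈ Set.Icc (0 : ℝ) 1)
    {B : ℝ → ℝ} {α : ℝ} (hα : 0 < α) (hU : IsIDC U B α) (hB : B α < 1) (q : 𝒬)
    (D : Database X) : linearValue (q : X → ℝ) D = 0 := by
  by_contra hne
  have hpos : 0 < linearValue (q : X → ℝ) D :=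
    lt_of_le_of_ne (Finset.sum_nonneg fun x _ => mul_nonneg (h𝒬 q q.2 x).1 (Nat.cast_nonneg _))
      (Ne.symm hne)
  obtain ⟨n, hn⟩ := exists_nat_gt ((α + U.eval q U.init) / linearValue (q : X → ℝ) D)
  rw [div_lt_iff₀ hpos] at hn
  have hval : linearValue (q : X → ℝ) (fun x => n * D x) = n * linearValue (q : X → ℝ) D := by
    unfold linearValue
    rw [Finset.mul_sum]
    refine Finset.sum_congr rfl fun x _ => ?_
    push_cast
    ring
  have := hU (fun x => n * D x) 1 (fun _ => U.init) (fun _ => q)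
    (fun _ => n * linearValue (q : X → ℝ) D)
    { start := fun _ => rfl
      distinguishes := fun _ => by
        rw [hval]
        exact le_trans (by linarith) (le_abs_self _)
      approximates := fun _ => by rw [hval]; simpa using hα
      step := fun t ht => absurd ht (by omega) }
  norm_num at this
  linarith

lemma run_eq_of_linearValue_eq {b T : ℝ} {A : List (𝒬 × ℝ) → 𝒬} {D D' : Database X}
    (hD : ∀ q : 𝒬, linearValue (q : X → ℝ) D = linearValue (q : X → ℝ) D') (zs : List ℝ) :
    ∀ (d : R) (C : ℕ) (h : List (𝒬 × ℝ)), run U b T D A zs d C h = run U b T D' A zs d C h := by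
  induction zs with
  | nil => intros; rfl
  | cons z zs ih => intro d C h; simp only [run, hD, ih]

end Queries

/-! ### The choice of the moment -/

/-- For the noise scale of the mechanism, the moment of order about `log (4 / δ) / ε` gives an
error below `δ`. -/
lemma exists_moment {b ε δ : ℝ} (hb : 1 ≤ b) (hε : ε ∈ Set.Ioc (0 : ℝ) 1)
    (hδ : δ ∈ Set.Ioc (0 : ℝ) 1) :
    1 ≤ noiseScale b ε δ ∧ ∃ m : ℕ, ((m + 1 : ℕ) : ℝ) * (2 / noiseScale b ε δ) ≤ 1 / 2 ∧
      0 < 1 - 4 * (((m + 1 : ℕ) : ℝ) * (2 / noiseScale b ε δ)) ^ 2 ∧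
      (1 / Real.exp ε) ^ m *
        (1 / (1 - 4 * (((m + 1 : ℕ) : ℝ) * (2 / noiseScale b ε δ)) ^ 2) ^ ⌈b⌉₊) ≤ δ := by
  obtain ⟨hε0, hε1⟩ := hε
  obtain ⟨hδ0, hδ1⟩ := hδ
  set L := Real.log (4 / δ) with hL
  have hL1 : 1 ≤ L := by
    rw [hL, Real.le_log_iff_exp_le (by positivity), le_div_iff₀ hδ0]
    nlinarith [Real.exp_one_lt_d9, Real.exp_pos 1]
  have hsq : 1 ≤ √b := Real.one_le_sqrt.2 hb
  have hLε : 1 ≤ L / ε := by rw [le_div_iff₀ hε0]; linarith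
  have hσ : noiseScale b ε δ = 1000 * √b * (L / ε) := by
    rw [noiseScale]; ring
  have hσpos : 0 < noiseScale b ε δ := by rw [hσ]; positivity
  refine ⟨?_, ⌈L / ε⌉₊, ?_⟩
  · rw [hσ]; nlinarith [mul_le_mul hsq hLε zero_le_one (by positivity)]
  set m := ⌈L / ε⌉₊
  have hm_ge : L / ε ≤ m := Nat.le_ceil _
  have hm_le : (m : ℝ) < L / ε + 1 := Nat.ceil_lt_add_one (by positivity)
  have hs : ((m + 1 : ℕ) : ℝ) * (2 / noiseScale b ε δ) ≤ 6 / (1000 * √b) := by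
    rw [← mul_div_assoc, div_le_div_iff₀ hσpos (by positivity), hσ]
    push_cast
    have : (m : ℝ) + 1 ≤ 3 * (L / ε) := by linarith
    calc ((m : ℝ) + 1) * 2 * (1000 * √b) ≤ 3 * (L / ε) * 2 * (1000 * √b) := by gcongr
      _ = 6 * (1000 * √b * (L / ε)) := by ring
  have hs0 : 0 ≤ ((m + 1 : ℕ) : ℝ) * (2 / noiseScale b ε δ) := by positivity
  generalize ((m + 1 : ℕ) : ℝ) * (2 / noiseScale b ε δ) = s at hs hs0 ⊢
  have hsb : s ^ 2 * b ≤ 36 / 1000000 := by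
    have h1 : s * √b ≤ 6 / 1000 := by
      calc s * √b ≤ 6 / (1000 * √b) * √b := by gcongr
        _ = 6 / 1000 := by field_simp
    calc s ^ 2 * b = (s * √b) ^ 2 := by rw [mul_pow, Real.sq_sqrt (by linarith)]
      _ ≤ (6 / 1000) ^ 2 := by gcongr
      _ = _ := by norm_num
  have hs2 : s ^ 2 ≤ 36 / 1000000 := by nlinarith [sq_nonneg s]
  have hκ : 0 < 1 - 4 * s ^ 2 := by linarith
  refine ⟨by nlinarith, hκ, ?_⟩
  have hN : (⌈b⌉₊ : ℝ) ≤ 2 * b := by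
    have := Nat.ceil_lt_add_one (show 0 ≤ b by linarith)
    linarith
  have hpow : 1 / 4 ≤ (1 - 4 * s ^ 2) ^ ⌈b⌉₊ := by
    have h1 := one_add_mul_le_pow (a := -(4 * s ^ 2)) (by linarith) ⌈b⌉₊
    have h2 : (⌈b⌉₊ : ℝ) * (4 * s ^ 2) ≤ 2 * b * (4 * s ^ 2) := by gcongr
    rw [← sub_eq_add_neg] at h1
    linarith
  have hexp : (1 / Real.exp ε) ^ m ≤ δ / 4 := by
    rw [one_div, ← Real.exp_neg, ← Real.exp_nat_mul,
      ← Real.le_log_iff_exp_le (by positivity), ← inv_div, Real.log_inv, ← hL]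
    rw [div_le_iff₀ hε0] at hm_ge
    linarith
  calc (1 / Real.exp ε) ^ m * (1 / (1 - 4 * s ^ 2) ^ ⌈b⌉₊)
      ≤ δ / 4 * (1 / (1 / 4)) := by gcongr
    _ = δ := by ring

end OnlineQuery

theorem mainTheorem1 {X R Ω : Type*} [Fintype X] [MeasurableSpace R] [MeasurableSpace Ω]
    (𝒬 : Set (X → ℝ)) (h𝒬 : ∀ Q ∈ 𝒬, ∀ x, Q x ∈ Set.Icc (0 : ℝ) 1)
    (U : OnlineQuery.UpdateRule 𝒬 R)
    (hupdate : Measurable fun p : R × 𝒬 × ℝ => U.update p.1 p.2.1 p.2.2)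
    (heval : Measurable fun p : 𝒬 × R => U.eval p.1 p.2)
    (B : ℝ → ℝ) (α : ℝ) (hα : 0 < α) (hU : OnlineQuery.IsIDC U B α)
    (ε δ β : ℝ) (hε : ε ∈ Set.Ioc (0 : ℝ) 1) (hδ : δ ∈ Set.Ioc (0 : ℝ) 1)
    (hβ : β ∈ Set.Ioc (0 : ℝ) 1) (k : ℕ)
    (ρ : MeasureTheory.Measure Ω) [MeasureTheory.IsProbabilityMeasure ρ]
    (A : Ω → List (𝒬 × ℝ) → 𝒬)
    (hA : Measurable fun p : Ω × List (𝒬 × ℝ) => A p.1 p.2) :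
    OnlineQuery.DifferentiallyPrivate ε δ
      (OnlineQuery.mechanism U B α ε δ β k ρ A) := by
  intro D D' hDD' S hS
  rcases lt_or_ge (B α) 1 with hB | hB
  · -- All queries are zero, so the output does not depend on the database. This case includes
    -- `B α = 0`, where the noise scale is `0`.
    have heq : OnlineQuery.mechanism U B α ε δ β k ρ A D
        = OnlineQuery.mechanism U B α ε δ β k ρ A D' := by
      unfold OnlineQuery.mechanism OnlineQuery.transcript
      congr 1
      funext p
      rw [OnlineQuery.run_eq_of_linearValue_eq fun q =>
        (OnlineQuery.linearValue_eq_zero_of_lt_one h𝒬 hα hU hB q D).trans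
          (OnlineQuery.linearValue_eq_zero_of_lt_one h𝒬 hα hU hB q D').symm]
    rw [heq]
    refine le_add_right (le_mul_of_one_le_left' ?_)
    rw [ENNReal.one_le_ofReal]
    exact Real.one_le_exp hε.1.le
  · obtain ⟨hσ, m, hm, hκ, hfinal⟩ := OnlineQuery.exists_moment hB hε hδ
    have hprob : IsProbabilityMeasure (OnlineQuery.laplace (OnlineQuery.noiseScale (B α) ε δ)) :=
      OnlineQuery.isProbabilityMeasure_laplace (by linarith)
    have hmeas : ∀ E : OnlineQuery.Database X, Measurable fun p : Ω × (Fin k → ℝ) =>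
        (p.1, OnlineQuery.transcript U (B α) (OnlineQuery.threshold (B α) ε δ β k) E
          (A p.1) k p.2) := fun E =>
      measurable_fst.prodMk ((OnlineQuery.measurable_run hupdate heval hA _ _ E k 0).comp
        (measurable_fst.prodMk (measurable_snd.prodMk (measurable_const (a := (U.init, []))))))
    unfold OnlineQuery.mechanism
    rw [Measure.map_apply (hmeas D) hS, Measure.map_apply (hmeas D') hS,
      Measure.prod_apply (hmeas D hS), Measure.prod_apply (hmeas D' hS),
      ← lintegral_const_mul' _ _ ENNReal.ofReal_ne_top]
    -- The bound holds for each value of the coins separately.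
    have hcoins : ENNReal.ofReal δ = ∫⁻ _ω, ENNReal.ofReal δ ∂ρ := by simp
    rw [hcoins, ← lintegral_add_right _ measurable_const]
    refine lintegral_mono fun ω => ?_
    have h := OnlineQuery.pi_laplace_run_le hupdate heval hA hσ
      (OnlineQuery.threshold (B α) ε δ β k)
      (fun q hq => OnlineQuery.abs_linearValue_sub_le_one (h𝒬 q hq) hDD') hm rfl hκ ω
      (measurable_prodMk_left hS : MeasurableSet (Prod.mk ω ⁻¹' S)) k 0 U.init []
      (b := B α) (by push_cast; linarith) (Real.exp ε) (Real.exp_pos ε)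
    rw [pow_zero] at h
    exact h.trans (add_le_add le_rfl (ENNReal.ofReal_le_ofReal hfinal))
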